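/- Let $p\in(0,1)$ be a constant and let $b=\frac{1}{1-p}$. Let $G(n,p)$ be the random graph on $n$ vertices in which each edge is present with probability $p$ independently of all other edges. A dominating $K_t$-model in a graph $G$ is a sequence $(T_1,\dots,T_t)$ of pairwise disjoint non-empty connected subgraphs of $G$ such that for $1\le i<j\le t$ every vertex of $T_j$ has a neighbour (in $G$) in $T_i$; the dominating Hadwiger number $\mathrm{domhad}(G)$ of a finite graph $G$ is the maximum integer $t$ such that $G$ contains a dominating $K_t$-model. Then asymptotically almost surely $$\mathrm{domhad}(G(n,p)) = (1+o(1))\,\frac{n}{\log_b n},$$ that is, for every $\varepsilon>0$, $$\lim_{n\to\infty}\mathbb{P}\left((1-\varepsilon)\frac{n}{\log_b n}\le \mathrm{domhad}(G(n,p))\le(1+\varepsilon)\frac{n}{\log_b n}\right)=1 .$$ -/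

import Mathlib

open Filter Topology MeasureTheory

namespace SimpleGraph

/-- A dominating `K_t`-model in `G`: a sequence `(T_0, …, T_{t-1})` of pairwise disjoint non-empty
connected subgraphs of `G` such that for `i < j` every vertex of `T_j` has a neighbour in `T_i`.
(`Subgraph.Connected` includes non-emptiness.) -/
structure IsDominatingModel {V : Type*} (G : SimpleGraph V) {t : ℕ}
    (T : Fin t → G.Subgraph) : Prop where
  connected : ∀ i, (T i).Connected
  disjoint : ∀ i j, i ≠ j → Disjoint (T i).verts (T j).verts
  dominating : ∀ i j, i < j → ∀ v ∈ (T j).verts, ∃ u ∈ (T i).verts, G.Adj v u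

/-- `G` contains a dominating `K_t`-model. -/
def HasDominatingModel {V : Type*} (G : SimpleGraph V) (t : ℕ) : Prop :=
  ∃ T : Fin t → G.Subgraph, G.IsDominatingModel T

/-- The dominating Hadwiger number of a finite graph `G`: the maximum `t` such that `G` contains a
dominating `K_t`-model. The supremum is attained, see `isGreatest_domHad`. -/
noncomputable def domHad {V : Type*} (G : SimpleGraph V) : ℕ :=
  sSup {t | G.HasDominatingModel t}

theorem HasDominatingModel.le_card {V : Type*} [Finite V] {G : SimpleGraph V} {t : ℕ}
    (h : G.HasDominatingModel t) : t ≤ Nat.card V := by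
  obtain ⟨T, hT⟩ := h
  choose f hf using fun i => (hT.connected i).nonempty
  have hinj : Function.Injective f := by
    intro i j hij
    by_contra hne
    exact Set.disjoint_left.mp (hT.disjoint i j hne) (hf i) (hij ▸ hf j)
  simpa using Nat.card_le_card_of_injective f hinj

theorem isGreatest_domHad {V : Type*} [Finite V] (G : SimpleGraph V) :
    IsGreatest {t | G.HasDominatingModel t} G.domHad := by
  have hb : BddAbove {t | G.HasDominatingModel t} := ⟨Nat.card V, fun _ h => h.le_card⟩
  have hne : {t | G.HasDominatingModel t}.Nonempty :=
    ⟨0, fun i => i.elim0, fun i => i.elim0, fun i => i.elim0, fun i => i.elim0⟩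
  exact ⟨Nat.sSup_mem hne hb, fun _ h => le_csSup hb h⟩

end SimpleGraph

/-!
Write `q = 1 - p` and `L = log_b n`, so that `q ^ (c * L) = n ^ (-c)`: a set of `c * L` vertices fails
to dominate a given vertex outside it with probability `n ^ (-c)`. Hence parts must have about `L`
vertices, and about `n / L` disjoint ones fit.

*Upper bound.* A dominating model with `t > (1 + ε) * n / L` parts has at least about `ε / 2 * n / L`
parts with at most `β * L` vertices, where `β = 1 / (1 + ε / 2) < 1`. For a fixed assignment of the
vertices to parts, and for small parts `i < j`, a chosen vertex of part `j` has a neighbour in part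
`i` with probability at most `1 - n ^ (-β)`, and these events concern disjoint sets of edges. Their
joint probability is at most `exp (- C * n ^ (2 - β) / L ^ 2)`, which beats the `n ^ n` possible
assignments (`binomialRandom_real_isDominatingLabelling_le`,
`binomialRandom_real_hasDominatingModel_le`). Connectedness of the parts plays no role here.

*Lower bound.* Cut the vertex set into consecutive blocks of length `s` about `(1 + δ) * L`. Call a
block good if any two of its vertices have a common neighbour inside it (which makes it connected)
and all its vertices are dominated by every other block. A block is not good with probability at most
`s ^ 2 * (1 - p ^ 2) ^ (s - 2) + n ^ (-δ)`, which tends to `0`, so by Markov's inequality all but a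
`δ`-fraction of the blocks are good with probability tending to `1`
(`binomialRandom_real_domHad_lt_le`). The good blocks form a dominating model.
-/

/-! ### Independence of the edges of the binomial random graph -/

namespace ProbabilityTheory

/-- Given independent events `X e` of probability `c` and disjoint blocks `B i`, the probability that
an event occurs in every block. -/
theorem measureReal_forall_exists_of_iIndepFun {Ω κ ι : Type*} [MeasurableSpace Ω]
    {μ : Measure Ω} [IsProbabilityMeasure μ] {X : κ → Ω → Prop} (hm : ∀ e, Measurable (X e))
    (hX : iIndepFun X μ) {c : ℝ} (I : Finset ι) (B : ι → Finset κ)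
    (hc : ∀ i ∈ I, ∀ e ∈ B i, μ.real {ω | X e ω} = c)
    (hB : ∀ i ∈ I, ∀ j ∈ I, i ≠ j → Disjoint (B i) (B j)) :
    μ.real {ω | ∀ i ∈ I, ∃ e ∈ B i, X e ω} = ∏ i ∈ I, (1 - (1 - c) ^ (B i).card) := by
  classical
  have key : ∀ S : Finset κ, (∀ e ∈ S, μ.real {ω | X e ω} = c) →
      μ.real {ω | ∃ e ∈ S, X e ω} = 1 - (1 - c) ^ S.card := by
    intro S hS
    have h1 : {ω | ∃ e ∈ S, X e ω} = (⋂ e ∈ S, X e ⁻¹' {False})ᶜ := by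
      ext ω; simp
    have hmeas : MeasurableSet (⋂ e ∈ S, X e ⁻¹' {False}) :=
      .biInter S.countable_toSet fun e _ => hm e (measurableSet_singleton _)
    rw [h1, probReal_compl_eq_one_sub hmeas, measureReal_def,
      hX.measure_inter_preimage_eq_mul S fun _ _ => measurableSet_singleton _, ENNReal.toReal_prod,
      Finset.prod_congr rfl (g := fun _ => 1 - c), Finset.prod_const]
    intro e he
    have h2 : X e ⁻¹' {False} = {ω | X e ω}ᶜ := by ext ω; simp
    rw [h2, ← measureReal_def, probReal_compl_eq_one_sub, hS e he]
    exact measurableSet_setOfPred.2 (hm e)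
  induction I using Finset.induction_on with
  | empty => simp
  | insert i I hi ih =>
    have hind := hX.indepFun_finset (B i) (I.biUnion B)
      (by
        rw [Finset.disjoint_biUnion_right]
        intro j hj
        exact hB i (by simp) j (by simp [hj]) (by rintro rfl; exact hi hj)) hm
    have h := hind.measure_inter_preimage_eq_mul
      {x | ∃ e : (B i : Finset κ), x e}
      {x | ∀ j, ∀ hj : j ∈ I, ∃ e, ∃ he : e ∈ B j, x ⟨e, Finset.mem_biUnion.2 ⟨j, hj, he⟩⟩}
      (Set.toFinite _).measurableSet (Set.toFinite _).measurableSet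
    have e1 : (fun a (i_1 : (B i : Finset κ)) ↦ X (↑i_1) a) ⁻¹' {x | ∃ e : (B i : Finset κ), x e}
        = {ω | ∃ e ∈ B i, X e ω} := by ext; simp
    have e2 : (fun a (i : (I.biUnion B : Finset κ)) ↦ X (↑i) a) ⁻¹'
        {x | ∀ j, ∀ hj : j ∈ I, ∃ e, ∃ he : e ∈ B j, x ⟨e, Finset.mem_biUnion.2 ⟨j, hj, he⟩⟩}
        = {ω | ∀ j ∈ I, ∃ e ∈ B j, X e ω} := by ext; simp
    rw [e1, e2] at h
    have h3 : {ω | ∀ j ∈ insert i I, ∃ e ∈ B j, X e ω} =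
        {ω | ∃ e ∈ B i, X e ω} ∩ {ω | ∀ j ∈ I, ∃ e ∈ B j, X e ω} := by
      ext; simp
    rw [h3, measureReal_def, h, ENNReal.toReal_mul, ← measureReal_def, ← measureReal_def,
      Finset.prod_insert hi, key _ (hc i (by simp)), ih]
    · exact fun j hj => hc j (by simp [hj])
    · exact fun j hj k hk => hB j (by simp [hj]) k (by simp [hk])

end ProbabilityTheory

namespace SimpleGraph

open ProbabilityTheory

variable {V : Type*}

theorem measurable_mem_edgeSet (e : Sym2 V) :
    Measurable fun G : SimpleGraph V => e ∈ G.edgeSet := by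
  induction e with
  | _ u v => simp only [mem_edgeSet]; fun_prop

instance [Finite V] : DiscreteMeasurableSpace (SimpleGraph V) where
  forall_measurableSet S :=
    measurableEmbedding_edgeSet.measurableSet_image.1 (edgeSet '' S).toFinite.measurableSet

theorem measurable_fromEdgeSet_setOf :
    Measurable fun f : Sym2 V → Prop => fromEdgeSet {e | f e} :=
  measurable_fromEdgeSet.comp (measurable_set_iff.2 fun e => measurable_pi_apply e)

variable [Countable V] (p : unitInterval)

/-- The binomial random graph as the image of a product measure, from which the independence of its
edges is inherited. -/
theorem binomialRandom_eq_map_infinitePi :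
    binomialRandom V p = (Measure.infinitePi fun e : Sym2 V =>
      unitInterval.toNNReal p • Measure.dirac (e ∈ (Sym2.diagSet)ᶜ) +
        unitInterval.toNNReal (unitInterval.symm p) • Measure.dirac False).map
      fun f => fromEdgeSet {e | f e} := by
  rw [binomialRandom_eq_map, setBernoulli_eq_map, Measure.map_map (by fun_prop)]
  · rfl
  · exact measurable_set_iff.2 fun e => measurable_pi_apply e

theorem binomialRandom_real_mem_edgeSet {e : Sym2 V} (he : ¬ e.IsDiag) :
    (binomialRandom V p).real {G | e ∈ G.edgeSet} = p := by
  have h : (fun f : Sym2 V → Prop => fromEdgeSet {e | f e}) ⁻¹' {G | e ∈ G.edgeSet} =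
      (fun f : Sym2 V → Prop => f e) ⁻¹' {True} := by
    ext f; simp [he]
  rw [binomialRandom_eq_map_infinitePi, map_measureReal_apply measurable_fromEdgeSet_setOf
      (measurableSet_setOfPred.2 (measurable_mem_edgeSet e)), h,
    ← map_measureReal_apply (measurable_pi_apply e) (measurableSet_singleton _),
    Measure.infinitePi_map_eval]
  simp [measureReal_def, he]

theorem iIndepFun_mem_edgeSet :
    iIndepFun (fun (e : Sym2 V) (G : SimpleGraph V) => e ∈ G.edgeSet) (binomialRandom V p) := by
  have h := iIndepFun_infinitePi (P := fun e : Sym2 V =>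
      unitInterval.toNNReal p • Measure.dirac (e ∈ (Sym2.diagSet)ᶜ) +
        unitInterval.toNNReal (unitInterval.symm p) • Measure.dirac False)
      (X := fun e x => x ∧ ¬ e.IsDiag) (fun e => by fun_prop)
  rw [iIndepFun_iff_measure_inter_preimage_eq_mul] at h ⊢
  intro S t ht
  have key (e : Sym2 V) : (fun f : Sym2 V → Prop => fromEdgeSet {e | f e}) ⁻¹'
      ((fun G : SimpleGraph V => e ∈ G.edgeSet) ⁻¹' t e) = (fun f => f e ∧ ¬ e.IsDiag) ⁻¹' t e := by
    ext f; simp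
  have hmeas (e) (he : e ∈ S) : MeasurableSet
      ((fun G : SimpleGraph V => e ∈ G.edgeSet) ⁻¹' t e) :=
    measurable_mem_edgeSet e (ht e he)
  have hmeas' : MeasurableSet (⋂ e ∈ S, (fun G : SimpleGraph V => e ∈ G.edgeSet) ⁻¹' t e) :=
    .biInter S.countable_toSet hmeas
  rw [binomialRandom_eq_map_infinitePi, Measure.map_apply measurable_fromEdgeSet_setOf hmeas',
    Set.preimage_iInter₂]
  simp only [key]
  rw [h S ht]
  refine Finset.prod_congr rfl fun e he => ?_
  rw [Measure.map_apply measurable_fromEdgeSet_setOf (hmeas e he), key]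

theorem binomialRandom_real_forall_exists_mem {ι : Type*} (I : Finset ι) (B : ι → Finset (Sym2 V))
    (hd : ∀ i ∈ I, ∀ e ∈ B i, ¬ e.IsDiag)
    (hB : ∀ i ∈ I, ∀ j ∈ I, i ≠ j → Disjoint (B i) (B j)) :
    (binomialRandom V p).real {G | ∀ i ∈ I, ∃ e ∈ B i, e ∈ G.edgeSet} =
      ∏ i ∈ I, (1 - (1 - (p : ℝ)) ^ (B i).card) :=
  measureReal_forall_exists_of_iIndepFun measurable_mem_edgeSet (iIndepFun_mem_edgeSet p) I B
    (fun i hi e he => binomialRandom_real_mem_edgeSet p (hd i hi e he)) hB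

theorem binomialRandom_real_forall_exists_notMem {ι : Type*} (I : Finset ι)
    (B : ι → Finset (Sym2 V)) (hd : ∀ i ∈ I, ∀ e ∈ B i, ¬ e.IsDiag)
    (hB : ∀ i ∈ I, ∀ j ∈ I, i ≠ j → Disjoint (B i) (B j)) :
    (binomialRandom V p).real {G | ∀ i ∈ I, ∃ e ∈ B i, e ∉ G.edgeSet} =
      ∏ i ∈ I, (1 - (p : ℝ) ^ (B i).card) := by
  have h := measureReal_forall_exists_of_iIndepFun (μ := binomialRandom V p)
    (X := fun e G => e ∉ G.edgeSet) (c := 1 - p)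
    (fun e => (measurable_mem_edgeSet e).not)
    ((iIndepFun_mem_edgeSet p).comp (fun _ x => ¬ x) fun _ => by fun_prop) I B
    (fun i hi e he => by
      rw [← binomialRandom_real_mem_edgeSet p (hd i hi e he), ← probReal_compl_eq_one_sub
        (measurableSet_setOfPred.2 (measurable_mem_edgeSet e))]
      rfl) hB
  simpa using h

theorem binomialRandom_real_forall_notMem (S : Finset (Sym2 V)) (hS : ∀ e ∈ S, ¬ e.IsDiag) :
    (binomialRandom V p).real {G | ∀ e ∈ S, e ∉ G.edgeSet} = (1 - (p : ℝ)) ^ S.card := by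
  simpa using binomialRandom_real_forall_exists_notMem p S (fun e => {e}) (by simpa using hS)
    (by simp)

end SimpleGraph

/-! ### Counting labellings -/

namespace SimpleGraph

theorem HasDominatingModel.mono {V : Type*} {G : SimpleGraph V} {s t : ℕ} (hst : s ≤ t)
    (h : G.HasDominatingModel t) : G.HasDominatingModel s := by
  obtain ⟨T, hT⟩ := h
  exact ⟨fun i => T (i.castLE hst), fun i => hT.connected _,
    fun i j hij => hT.disjoint _ _ (by simpa using hij),
    fun i j hij => hT.dominating _ _ (by simpa using hij)⟩

/-- The vertex labelling `f` is compatible with `G` when every vertex with label `some j` has, for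
each `i < j`, a neighbour with label `some i`. The label `none` is for vertices outside all parts;
connectedness of the parts is not required. -/
def IsDominatingLabelling {V : Type*} {t : ℕ} (f : V → Option (Fin t)) (G : SimpleGraph V) : Prop :=
  ∀ i j, i < j → ∀ v, f v = some j → ∃ u, f u = some i ∧ G.Adj v u

theorem HasDominatingModel.exists_isDominatingLabelling {V : Type*} {G : SimpleGraph V} {t : ℕ}
    (h : G.HasDominatingModel t) :
    ∃ f : V → Option (Fin t), (∀ i, ∃ v, f v = some i) ∧ IsDominatingLabelling f G := by
  classical
  obtain ⟨T, hT⟩ := h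
  let f : V → Option (Fin t) := fun v =>
    if h : ∃ i, v ∈ (T i).verts then some h.choose else none
  have hf (v i) : f v = some i ↔ v ∈ (T i).verts := by
    by_cases h : ∃ i, v ∈ (T i).verts
    · have hc := h.choose_spec
      simp only [f, dif_pos h, Option.some.injEq]
      refine ⟨fun hi => hi ▸ hc, fun hv => ?_⟩
      by_contra hne
      exact Set.disjoint_left.mp (hT.disjoint _ _ hne) hc hv
    · simp only [f, dif_neg h, reduceCtorEq, false_iff]
      exact fun hv => h ⟨i, hv⟩
  refine ⟨f, fun i => ?_, fun i j hij v hv => ?_⟩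
  · obtain ⟨v, hv⟩ := (hT.connected i).nonempty
    exact ⟨v, (hf v i).2 hv⟩
  · obtain ⟨u, hu, huv⟩ := hT.dominating i j hij v ((hf v j).1 hv)
    exact ⟨u, (hf u i).2 hu, huv⟩

theorem _root_.Finset.card_filter_lt_product {α : Type*} [LinearOrder α] (S : Finset α) :
    ((S ×ˢ S).filter fun x => x.1 < x.2).card = S.card.choose 2 := by
  have h1 : S.offDiag = ((S ×ˢ S).filter fun x => x.1 < x.2) ∪
      ((S ×ˢ S).filter fun x => x.2 < x.1) := by
    ext ⟨a, b⟩
    simp only [Finset.mem_offDiag, Finset.mem_union, Finset.mem_filter, Finset.mem_product,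
      ne_iff_lt_or_gt]
    tauto
  have h2 : ((S ×ˢ S).filter fun x => x.2 < x.1).card =
      ((S ×ˢ S).filter fun x => x.1 < x.2).card := by
    refine Finset.card_bij' (fun x _ => x.swap) (fun x _ => x.swap) ?_ ?_ ?_ ?_ <;>
      simp +contextual
  have h3 := congrArg Finset.card h1
  rw [Finset.card_union_of_disjoint, h2, Finset.offDiag_card] at h3
  · rw [Nat.choose_two_right, Nat.mul_sub_one]
    omega
  · rw [Finset.disjoint_filter]
    exact fun x _ h h' => lt_asymm h h'

variable {V : Type*} [Fintype V] (p : unitInterval)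

/-- For a fixed labelling, look only at parts with at most `a` vertices and one representative of
each: the representative of part `j` has a neighbour in part `i` with probability at most
`1 - (1 - p) ^ a`, and for distinct pairs `i < j` these events concern disjoint sets of edges. -/
theorem binomialRandom_real_isDominatingLabelling_le {t : ℕ} (f : V → Option (Fin t))
    (hf : ∀ i, ∃ v, f v = some i) {a k : ℕ}
    (hk : Fintype.card V + k * (a + 1) ≤ t * (a + 1)) :
    (binomialRandom V p).real {G | IsDominatingLabelling f G} ≤
      (1 - (1 - (p : ℝ)) ^ a) ^ k.choose 2 := by
  classical
  have hp0 := p.2.1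
  have hp1 := p.2.2
  -- `r j` represents part `j`, `A j` is the part itself, and `S` is the set of small parts
  choose r hr using hf
  let A : Fin t → Finset V := fun i => Finset.univ.filter fun v => f v = some i
  let S : Finset (Fin t) := Finset.univ.filter fun i => (A i).card ≤ a
  have hA {v i} : v ∈ A i ↔ f v = some i := by simp [A]
  have hS : k ≤ S.card := by
    have h1 : ∑ i ∈ Sᶜ, (A i).card ≤ Fintype.card V := by
      rw [← Finset.card_biUnion]
      · exact Finset.card_le_univ _
      · intro i _ j _ hij
        rw [Function.onFun, Finset.disjoint_left]
        intro v hi hj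
        rw [hA] at hi hj
        exact hij (by simpa [hi] using hj)
    have h2 : Sᶜ.card * (a + 1) ≤ ∑ i ∈ Sᶜ, (A i).card := by
      rw [← smul_eq_mul]
      refine Finset.card_nsmul_le_sum _ _ _ fun i hi => ?_
      simp only [S, Finset.mem_compl, Finset.mem_filter, Finset.mem_univ, true_and] at hi
      omega
    have h3 : Sᶜ.card = t - S.card := by simp [Finset.card_compl]
    have h4 : S.card ≤ t := by simpa using Finset.card_le_univ S
    have h5 : (Sᶜ.card + k) * (a + 1) ≤ t * (a + 1) := by rw [add_mul]; omega
    have := Nat.le_of_mul_le_mul_right h5 (by omega)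
    omega
  let Q := (S ×ˢ S).filter fun x => x.1 < x.2
  let B : Fin t × Fin t → Finset (Sym2 V) := fun x => (A x.1).image fun u => s(r x.2, u)
  have hB (x) : (B x).card = (A x.1).card :=
    Finset.card_image_of_injective _ fun u v h => Sym2.congr_right.1 h
  have hy0 : 0 ≤ 1 - (1 - (p : ℝ)) ^ a := sub_nonneg.2 (pow_le_one₀ (by linarith) (by linarith))
  calc (binomialRandom V p).real {G | IsDominatingLabelling f G}
      ≤ (binomialRandom V p).real {G | ∀ x ∈ Q, ∃ e ∈ B x, e ∈ G.edgeSet} := by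
        refine measureReal_mono fun G hG x hx => ?_
        obtain ⟨u, hu, huv⟩ := hG x.1 x.2 (Finset.mem_filter.1 hx).2 (r x.2) (hr _)
        exact ⟨s(r x.2, u), Finset.mem_image_of_mem _ (hA.2 hu), huv⟩
    _ = ∏ x ∈ Q, (1 - (1 - (p : ℝ)) ^ (B x).card) := by
        refine binomialRandom_real_forall_exists_mem p Q B ?_ ?_
        · intro x hx e he
          obtain ⟨u, hu, rfl⟩ := Finset.mem_image.1 he
          rw [hA] at hu
          rw [Sym2.mk_isDiag_iff]
          rintro h
          have hlt := (Finset.mem_filter.1 hx).2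
          rw [← h, hr, Option.some_inj] at hu
          exact hlt.ne' hu
        · rintro ⟨i, j⟩ hx ⟨i', j'⟩ hx' hne
          have hlt : i < j := (Finset.mem_filter.1 hx).2
          have hlt' : i' < j' := (Finset.mem_filter.1 hx').2
          rw [Finset.disjoint_left]
          intro e he he'
          obtain ⟨u, hu, rfl⟩ := Finset.mem_image.1 he
          obtain ⟨u', hu', h⟩ := Finset.mem_image.1 he'
          simp only [hA] at hu hu'
          rw [Sym2.eq_iff] at h
          -- an edge in `B (i, j)` has ends labelled `i < j`, so it determines the pair
          rcases h with ⟨h1, h2⟩ | ⟨h1, h2⟩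
          · have e1 := hr j'
            simp only at h1
            rw [h1, hr, Option.some_inj] at e1
            rw [h2, hu, Option.some_inj] at hu'
            exact hne (by rw [e1, hu'])
          · have e1 := hr j'
            simp only at h1 h2
            rw [h1, hu, Option.some_inj] at e1
            rw [h2, hr, Option.some_inj] at hu'
            order
    _ ≤ ∏ x ∈ Q, (1 - (1 - (p : ℝ)) ^ a) := by
        refine Finset.prod_le_prod (fun x _ => ?_) fun x hx => ?_
        · exact sub_nonneg.2 (pow_le_one₀ (by linarith) (by linarith))
        · have : (A x.1).card ≤ a := by
            have := (Finset.mem_product.1 (Finset.mem_filter.1 hx).1).1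
            simpa [S] using this
          rw [hB]
          gcongr ?_ - ?_
          exact pow_le_pow_of_le_one (by linarith) (by linarith) this
    _ = (1 - (1 - (p : ℝ)) ^ a) ^ S.card.choose 2 := by
        rw [Finset.prod_const, Finset.card_filter_lt_product]
    _ ≤ (1 - (1 - (p : ℝ)) ^ a) ^ k.choose 2 := by
        refine pow_le_pow_of_le_one hy0 ?_ (Nat.choose_le_choose 2 hS)
        have := pow_nonneg (sub_nonneg.2 hp1) a
        linarith

/-- The union bound over all labellings with nonempty classes. -/
theorem binomialRandom_real_hasDominatingModel_le {t a k : ℕ}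
    (hk : Fintype.card V + k * (a + 1) ≤ t * (a + 1)) :
    (binomialRandom V p).real {G | G.HasDominatingModel t} ≤
      ((t : ℝ) + 1) ^ Fintype.card V * (1 - (1 - (p : ℝ)) ^ a) ^ k.choose 2 := by
  classical
  let F : Finset (V → Option (Fin t)) := Finset.univ.filter fun f => ∀ i, ∃ v, f v = some i
  have hp0 := p.2.1
  have hp1 := p.2.2
  calc (binomialRandom V p).real {G | G.HasDominatingModel t}
      ≤ (binomialRandom V p).real (⋃ f ∈ F, {G | IsDominatingLabelling f G}) := by
        refine measureReal_mono (fun G hG => ?_) (measure_ne_top _ _)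
        obtain ⟨f, hf, h⟩ := HasDominatingModel.exists_isDominatingLabelling hG
        exact Set.mem_biUnion (show f ∈ F by simpa [F] using hf) h
    _ ≤ ∑ f ∈ F, (binomialRandom V p).real {G | IsDominatingLabelling f G} :=
        measureReal_biUnion_finset_le _ _
    _ ≤ ∑ f ∈ F, (1 - (1 - (p : ℝ)) ^ a) ^ k.choose 2 :=
        Finset.sum_le_sum fun f hf => binomialRandom_real_isDominatingLabelling_le p f
          (by simpa [F] using hf) hk
    _ ≤ ((t : ℝ) + 1) ^ Fintype.card V * (1 - (1 - (p : ℝ)) ^ a) ^ k.choose 2 := by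
        rw [Finset.sum_const, nsmul_eq_mul]
        gcongr
        · exact pow_nonneg (sub_nonneg.2 (pow_le_one₀ (by linarith) (by linarith))) _
        · have : F.card ≤ (t + 1) ^ Fintype.card V := by
            simpa using Finset.card_le_univ F
          exact_mod_cast this

end SimpleGraph

/-! ### Dominating models from good parts -/

namespace SimpleGraph

section
variable {V : Type*} [Countable V] (p : unitInterval)

theorem binomialRandom_real_forall_not_adj (v : V) (W : Finset V) (hv : v ∉ W) :
    (binomialRandom V p).real {G | ∀ u ∈ W, ¬ G.Adj v u} = (1 - (p : ℝ)) ^ W.card := by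
  classical
  have h := binomialRandom_real_forall_notMem p (W.image fun u => s(v, u)) (by
    intro e he
    obtain ⟨u, hu, rfl⟩ := Finset.mem_image.1 he
    rw [Sym2.mk_isDiag_iff]
    rintro rfl
    exact hv hu)
  rw [Finset.card_image_of_injective _ fun u w h => Sym2.congr_right.1 h] at h
  simpa using h

theorem binomialRandom_real_forall_not_adj_and_adj {u v : V} (huv : u ≠ v) (W : Finset V)
    (hu : u ∉ W) (hv : v ∉ W) :
    (binomialRandom V p).real {G | ∀ w ∈ W, ¬ (G.Adj u w ∧ G.Adj v w)} =
      (1 - (p : ℝ) ^ 2) ^ W.card := by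
  classical
  have h := binomialRandom_real_forall_exists_notMem p W (fun w => {s(u, w), s(v, w)}) (by
    intro w hw e he
    simp only [Finset.mem_insert, Finset.mem_singleton] at he
    rcases he with rfl | rfl <;> rw [Sym2.mk_isDiag_iff] <;> rintro rfl <;> contradiction) (by
    intro w hw w' hw' hne
    have h1 : u ≠ w := fun h => hu (h ▸ hw)
    have h2 : v ≠ w := fun h => hv (h ▸ hw)
    simp only [Finset.disjoint_insert_left, Finset.disjoint_singleton_left, Finset.mem_insert,
      Finset.mem_singleton, Sym2.eq_iff]
    have h3 : u ≠ w' := fun h => hu (h ▸ hw')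
    grind)
  have hc (w : V) : ({s(u, w), s(v, w)} : Finset (Sym2 V)).card = 2 :=
    Finset.card_pair fun h => huv (Sym2.congr_left.1 h)
  simp only [hc, Finset.prod_const] at h
  rw [← h]
  congr 1
  ext G
  simp only [Set.mem_ofPred_eq, Finset.mem_insert, Finset.mem_singleton, exists_eq_or_imp,
    exists_eq_left, mem_edgeSet, not_and_or]

end

/-- Among the sets `P i`, the set `P j` is good if any two of its vertices have a common neighbour
in it, and each of its vertices has a neighbour in all other `P i`. The first condition, stronger
than connectedness, has an easily bounded failure probability; the second one refers to all other
sets, so that any collection of good parts, in any order, is a dominating model. -/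
def IsGoodPart {V ι : Type*} (P : ι → Finset V) (j : ι) (G : SimpleGraph V) : Prop :=
  (∀ u ∈ P j, ∀ v ∈ P j, u ≠ v → ∃ w ∈ P j, G.Adj u w ∧ G.Adj v w) ∧
    ∀ v ∈ P j, ∀ i, i ≠ j → ∃ u ∈ P i, G.Adj v u

theorem IsGoodPart.connected {V ι : Type*} {P : ι → Finset V} {j : ι} {G : SimpleGraph V}
    (h : IsGoodPart P j G) (hne : (P j).Nonempty) :
    ((⊤ : G.Subgraph).induce (P j : Set V)).Connected := by
  rw [← connected_induce_iff, connected_iff]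
  refine ⟨fun u v => ?_, hne.to_subtype⟩
  by_cases huv : u = v
  · rw [huv]
  · obtain ⟨w, hw, h1, h2⟩ := h.1 u u.2 v v.2 fun h => huv (Subtype.ext h)
    have e1 : (G.induce (P j : Set V)).Adj u ⟨w, hw⟩ := h1
    have e2 : (G.induce (P j : Set V)).Adj v ⟨w, hw⟩ := h2
    exact e1.reachable.trans e2.symm.reachable

theorem hasDominatingModel_of_isGoodPart {V ι : Type*} {P : ι → Finset V} {G : SimpleGraph V}
    (hP : ∀ i j, i ≠ j → Disjoint (P i) (P j)) (hne : ∀ i, (P i).Nonempty) (J : Finset ι)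
    (hJ : ∀ j ∈ J, IsGoodPart P j G) : G.HasDominatingModel J.card := by
  let e := J.equivFin.symm
  have he (i j) (hij : i ≠ j) : (e i : ι) ≠ e j := by
    rwa [ne_eq, Subtype.coe_inj, e.injective.eq_iff]
  refine ⟨fun i => (⊤ : G.Subgraph).induce (P (e i) : Set V), fun i => ?_, fun i j hij => ?_,
    fun i j hij v hv => ?_⟩
  · exact (hJ _ (e i).2).connected (hne _)
  · simpa using hP _ _ (he i j hij)
  · exact (hJ _ (e j).2).2 v hv _ (he i j hij.ne)

variable {V ι : Type*} [Fintype V] [Fintype ι] (p : unitInterval)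

theorem binomialRandom_real_not_isGoodPart_le {P : ι → Finset V}
    (hP : ∀ i j, i ≠ j → Disjoint (P i) (P j)) {s : ℕ} (hs : ∀ i, (P i).card = s) (j : ι) :
    (binomialRandom V p).real {G | ¬ IsGoodPart P j G} ≤
      (s : ℝ) ^ 2 * (1 - (p : ℝ) ^ 2) ^ (s - 2) + s * Fintype.card ι * (1 - (p : ℝ)) ^ s := by
  classical
  have hp0 := p.2.1
  have hp1 := p.2.2
  have hpp : (0 : ℝ) ≤ 1 - (p : ℝ) ^ 2 := sub_nonneg.2 (pow_le_one₀ hp0 hp1)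
  -- `D` indexes the failures of the first condition, `E` those of the second
  let D := (P j).offDiag
  let E := P j ×ˢ (Finset.univ.erase j)
  have hD : D.card ≤ s ^ 2 := by
    rw [Finset.offDiag_card, hs, sq]; exact Nat.sub_le _ _
  have hE : E.card ≤ s * Fintype.card ι := by
    rw [Finset.card_product, hs]
    exact Nat.mul_le_mul_left _ (Finset.card_le_univ _)
  calc (binomialRandom V p).real {G | ¬ IsGoodPart P j G}
      ≤ (binomialRandom V p).real
        ((⋃ x ∈ D, {G | ∀ w ∈ (P j \ {x.1, x.2}), ¬ (G.Adj x.1 w ∧ G.Adj x.2 w)}) ∪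
          ⋃ x ∈ E, {G | ∀ u ∈ P x.2, ¬ G.Adj x.1 u}) := by
        refine measureReal_mono (fun G hG => ?_) (measure_ne_top _ _)
        rw [Set.mem_ofPred_eq, IsGoodPart, not_and_or] at hG
        push Not at hG
        rcases hG with ⟨u, hu, v, hv, huv, h⟩ | ⟨v, hv, i, hij, h⟩
        · refine Or.inl (Set.mem_biUnion (x := (u, v)) ?_ ?_)
          · simp [D, hu, hv, huv]
          · intro w hw hh
            exact h w (Finset.mem_sdiff.1 hw).1 hh.1 hh.2
        · refine Or.inr (Set.mem_biUnion (x := (v, i)) ?_ h)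
          simp [E, hv, hij]
    _ ≤ ∑ x ∈ D, (1 - (p : ℝ) ^ 2) ^ (s - 2) + ∑ x ∈ E, (1 - (p : ℝ)) ^ s := by
        refine (measureReal_union_le _ _).trans (add_le_add ?_ ?_)
        · refine (measureReal_biUnion_finset_le _ _).trans (Finset.sum_le_sum fun x hx => ?_)
          obtain ⟨h1, h2, h3⟩ := Finset.mem_offDiag.1 hx
          rw [binomialRandom_real_forall_not_adj_and_adj p h3 _ (by simp) (by simp),
            Finset.card_sdiff_of_subset (by simp [Finset.insert_subset_iff, h1, h2]), hs,
            Finset.card_pair h3]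
        · refine (measureReal_biUnion_finset_le _ _).trans (Finset.sum_le_sum fun x hx => ?_)
          obtain ⟨h1, h2⟩ := Finset.mem_product.1 hx
          rw [binomialRandom_real_forall_not_adj, hs]
          exact Finset.disjoint_left.1 (hP j x.2 (Finset.ne_of_mem_erase h2).symm) h1
    _ ≤ _ := by
        rw [Finset.sum_const, Finset.sum_const, nsmul_eq_mul, nsmul_eq_mul]
        gcongr
        · exact_mod_cast hD
        · exact_mod_cast hE

/-- Markov's inequality for the number of parts that are not good; the good ones form a dominating
model. -/
theorem binomialRandom_real_domHad_lt_le {P : ι → Finset V}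
    (hP : ∀ i j, i ≠ j → Disjoint (P i) (P j)) {s : ℕ} (hs0 : 0 < s) (hs : ∀ i, (P i).card = s)
    {d : ℝ} (hd : 0 < d) :
    (binomialRandom V p).real {G | (G.domHad : ℝ) < Fintype.card ι - d} ≤
      Fintype.card ι * ((s : ℝ) ^ 2 * (1 - (p : ℝ) ^ 2) ^ (s - 2) +
        s * Fintype.card ι * (1 - (p : ℝ)) ^ s) / d := by
  classical
  -- the number of parts that are not good, as a sum of indicators
  let N : SimpleGraph V → ℝ := fun G => ∑ j : ι, {G | ¬ IsGoodPart P j G}.indicator 1 G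
  have hN (G) : N G = (Finset.univ.filter fun j => ¬ IsGoodPart P j G).card := by
    simp [N, Set.indicator_apply, Finset.sum_ite]
  have hNnn (G) : 0 ≤ N G := by rw [hN]; positivity
  rw [le_div_iff₀' hd]
  calc d * (binomialRandom V p).real {G | (G.domHad : ℝ) < Fintype.card ι - d}
      ≤ d * (binomialRandom V p).real {G | d ≤ N G} := by
        gcongr ?_ * ?_
        refine measureReal_mono (fun G hG => ?_) (measure_ne_top _ _)
        have h1 := (isGreatest_domHad G).2 (hasDominatingModel_of_isGoodPart hP
          (fun i => Finset.card_pos.1 (by rw [hs]; exact hs0))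
          (Finset.univ.filter fun j => IsGoodPart P j G) (by simp))
        have h2 := Finset.card_filter_add_card_filter_not (s := (Finset.univ : Finset ι))
          fun j => IsGoodPart P j G
        rw [Finset.card_univ] at h2
        have h3 : (Fintype.card ι : ℝ) ≤ G.domHad +
            (Finset.univ.filter fun j => ¬ IsGoodPart P j G).card := by
          exact_mod_cast h2 ▸ Nat.add_le_add_right h1 _
        rw [Set.mem_ofPred_eq] at hG ⊢
        rw [hN]
        linarith
    _ ≤ ∫ G, N G ∂(binomialRandom V p) :=
        mul_meas_ge_le_integral_of_nonneg (.of_forall hNnn) .of_finite d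
    _ = ∑ j : ι, (binomialRandom V p).real {G | ¬ IsGoodPart P j G} := by
        rw [integral_finsetSum _ fun _ _ => .of_finite]
        exact Finset.sum_congr rfl fun j _ => integral_indicator_one (.of_discrete)
    _ ≤ _ := by
        refine (Finset.sum_le_card_nsmul _ _ _ fun j _ =>
          binomialRandom_real_not_isGoodPart_le p hP hs j).trans_eq ?_
        rw [nsmul_eq_mul, Finset.card_univ]

end SimpleGraph

/-! ### Asymptotics of the base-`1 / q` logarithm -/

namespace SimpleGraph

theorem tendsto_logb_natCast_atTop {q : ℝ} (hq0 : 0 < q) (hq1 : q < 1) :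
    Tendsto (fun n : ℕ => Real.logb (1 / q) n) atTop atTop :=
  (Real.tendsto_logb_atTop (one_lt_one_div hq0 hq1)).comp tendsto_natCast_atTop_atTop

/-- With `L = logb (1 / q) x`, the power `q ^ (c * L)` is `x ^ (-c)`: a set of `c * L` vertices fails
to dominate a given outside vertex with probability `x ^ (-c)`. -/
theorem rpow_mul_logb_one_div {q : ℝ} (hq0 : 0 < q) (hq1 : q < 1) (c : ℝ) {x : ℝ}
    (hx : 0 < x) :
    q ^ (c * Real.logb (1 / q) x) = x ^ (-c) := by
  have h := Real.rpow_logb (b := 1 / q) (by positivity) (one_lt_one_div hq0 hq1).ne' hx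
  conv_rhs => rw [← h]
  rw [one_div, Real.inv_rpow hq0.le, Real.inv_rpow (by positivity), ← Real.rpow_mul hq0.le,
    ← Real.rpow_neg hq0.le]
  ring_nf

theorem tendsto_logb_natCast_div_nhds_zero (q : ℝ) :
    Tendsto (fun n : ℕ => Real.logb (1 / q) n / n) atTop (𝓝 0) := by
  have h := (Real.isLittleO_log_id_atTop.tendsto_div_nhds_zero.comp
    tendsto_natCast_atTop_atTop).div_const (Real.log (1 / q))
  rw [zero_div] at h
  refine h.congr fun n => ?_
  simp only [Function.comp_apply, id_eq, Real.logb]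
  ring

theorem tendsto_div_logb_natCast_atTop {q : ℝ} (hq0 : 0 < q) (hq1 : q < 1) :
    Tendsto (fun n : ℕ => (n : ℝ) / Real.logb (1 / q) n) atTop atTop := by
  have h : Tendsto (fun n : ℕ => Real.logb (1 / q) n / n) atTop (𝓝[>] 0) := by
    refine tendsto_nhdsWithin_iff.2 ⟨tendsto_logb_natCast_div_nhds_zero q, ?_⟩
    filter_upwards [(tendsto_logb_natCast_atTop hq0 hq1).eventually_gt_atTop 0,
      eventually_gt_atTop 0] with n hn h0
    exact div_pos hn (by exact_mod_cast h0)
  exact h.inv_tendsto_nhdsGT_zero.congr fun n => by simp only [Pi.inv_apply, inv_div]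

/-! ### The upper bound on the dominating Hadwiger number -/

/-- The union bound over at most `n ^ n` labellings, with `t` just above `(1 + ε) * n / L`. At
least about `ε / 2 * n / L` of the `t` parts have at most `β * L` vertices, where `β < 1`, which gives
order `n ^ 2 / L ^ 2` required events, each failing with probability at least `n ^ (-β)`. -/
theorem tendsto_binomialRandom_real_lt_domHad {p : unitInterval} (hp0 : 0 < p) (hp1 : p < 1)
    {ε : ℝ} (hε : 0 < ε) :
    Tendsto (fun n : ℕ => (binomialRandom (Fin n) p).real
      {G | (1 + ε) * (n / Real.logb (1 / (1 - (p : ℝ))) n) < (G.domHad : ℝ)}) atTop (𝓝 0) := by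
  have hp0' : (0 : ℝ) < p := hp0
  have hp1' : (p : ℝ) < 1 := hp1
  set q : ℝ := 1 - p with hq
  have hq0 : 0 < q := by linarith
  have hq1 : q < 1 := by linarith
  have hL := tendsto_logb_natCast_atTop hq0 hq1
  set lam := Real.log (1 / q) with hlam
  have hlam0 : 0 < lam := Real.log_pos (one_lt_one_div hq0 hq1)
  -- with this `β`, at most `n / (β * L) = (1 + ε / 2) * n / L` parts have more than `β * L` vertices
  set β : ℝ := 1 / (1 + ε / 2) with hβ
  have hβ0 : 0 < β := by positivity
  have hβ1 : β < 1 := by rw [hβ, div_lt_one (by positivity)]; linarith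
  set c : ℝ := ε ^ 2 * lam ^ 2 / 32 with hc
  have hc0 : 0 < c := by positivity
  have hlog : ∀ᶠ n : ℕ in atTop, 2 * Real.log n ^ 3 ≤ c * (n : ℝ) ^ (1 - β) := by
    have h := (isLittleO_log_rpow_rpow_atTop 3 (sub_pos.2 hβ1)).bound (half_pos hc0)
    filter_upwards [tendsto_natCast_atTop_atTop.eventually h, eventually_ge_atTop 1] with n hn h1
    have h1' : (1 : ℝ) ≤ n := by exact_mod_cast h1
    have h2 := Real.log_nonneg h1'
    rw [Real.norm_of_nonneg (by positivity), Real.norm_of_nonneg (by positivity)] at hn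
    norm_cast at hn
    linarith
  have hexp : Tendsto (fun n : ℕ => Real.exp (-(n : ℝ))) atTop (𝓝 0) :=
    Real.tendsto_exp_neg_atTop_nhds_zero.comp tendsto_natCast_atTop_atTop
  refine squeeze_zero' (.of_forall fun n => measureReal_nonneg) ?_ hexp
  filter_upwards [hlog, hL.eventually_ge_atTop (2 * (1 + ε)), eventually_ge_atTop 4,
    (tendsto_div_logb_natCast_atTop hq0 hq1).eventually_ge_atTop (8 / ε),
    (Real.tendsto_log_atTop.comp tendsto_natCast_atTop_atTop).eventually_ge_atTop 1]
    with n hn hLn h4 hx8 hlog1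
  set L := Real.logb (1 / q) n with hLdef
  set x : ℝ := n / L with hx
  have hL0 : 0 < L := by linarith
  have hn4 : (4 : ℝ) ≤ n := by exact_mod_cast h4
  have hn0 : (0 : ℝ) < n := by linarith
  have hx0 : 0 < x := by positivity
  have hLlog : L = Real.log n / lam := rfl
  simp only [Function.comp_apply] at hlog1
  set t := ⌊(1 + ε) * x⌋₊ + 1 with ht
  set a := ⌊β * L⌋₊ with ha
  set k := ⌊ε / 2 * x⌋₊ with hk
  have ht1 : (1 + ε) * x < t := by rw [ht]; push_cast; exact Nat.lt_floor_add_one _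
  have ht2 : (t : ℝ) ≤ (1 + ε) * x + 1 := by
    rw [ht]; push_cast; gcongr; exact Nat.floor_le (by positivity)
  have ha1 : β * L < a + 1 := Nat.lt_floor_add_one _
  have ha2 : (a : ℝ) ≤ β * L := Nat.floor_le (by positivity)
  have hk1 : ε / 2 * x < k + 1 := Nat.lt_floor_add_one _
  have hk2 : (k : ℝ) ≤ ε / 2 * x := Nat.floor_le (by positivity)
  have hεx : 8 ≤ ε * x := by rwa [div_le_iff₀' hε] at hx8
  have hcount : Fintype.card (Fin n) + k * (a + 1) ≤ t * (a + 1) := by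
    rw [Fintype.card_fin]
    have h1 : (1 + ε / 2) * x ≤ t - k := by linarith
    have h2 : (n : ℝ) = (1 + ε / 2) * x * (β * L) := by
      rw [hβ, hx]; field_simp
    have h3 : (1 + ε / 2) * x * (β * L) ≤ (t - k) * (a + 1) :=
      mul_le_mul h1 ha1.le (by positivity) ((by positivity : (0 : ℝ) ≤ _).trans h1)
    have h4 : (n : ℝ) + k * (a + 1) ≤ t * (a + 1) := by linarith
    exact_mod_cast h4
  have ht3 : (t : ℝ) + 1 ≤ n := by
    have h1 : (1 + ε) * x ≤ n / 2 := by
      rw [hx, mul_div_assoc', div_le_div_iff₀ hL0 two_pos]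
      nlinarith
    linarith
  have hqa : (n : ℝ) ^ (-β) ≤ q ^ a := by
    rw [← rpow_mul_logb_one_div hq0 hq1 β hn0, ← Real.rpow_natCast]
    exact Real.rpow_le_rpow_of_exponent_ge hq0 hq1.le ha2
  have hchoose : ε ^ 2 * x ^ 2 / 32 ≤ (k.choose 2 : ℝ) := by
    rw [Nat.cast_choose_two]
    have h1 : ε * x / 4 ≤ k := by linarith
    have h2 : ε * x / 4 ≤ k - 1 := by linarith
    have h3 := mul_le_mul h1 h2 (by positivity) (by positivity)
    linarith
  -- `n ^ (2 - β)` over `L ^ 2` beats `n * log n`, the logarithm of the number of labellings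
  have hmain : n * Real.log n + n ≤ (n : ℝ) ^ (-β) * (ε ^ 2 * x ^ 2 / 32) := by
    have h1 : (n : ℝ) ^ (-β) * (ε ^ 2 * x ^ 2 / 32) =
        c * (n : ℝ) ^ (1 - β) * n / Real.log n ^ 2 := by
      rw [show (1 - β) = -β + 1 by ring, Real.rpow_add_one hn0.ne', hx, hLlog, hc]
      field_simp
    rw [h1, le_div_iff₀ (by positivity)]
    have h2 : Real.log n ^ 2 ≤ Real.log n ^ 3 := pow_le_pow_right₀ hlog1 (by norm_num)
    calc (n * Real.log n + n) * Real.log n ^ 2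
        = n * (Real.log n ^ 3 + Real.log n ^ 2) := by ring
      _ ≤ n * (2 * Real.log n ^ 3) := by gcongr; linarith
      _ ≤ n * (c * (n : ℝ) ^ (1 - β)) := by gcongr
      _ = _ := by ring
  have hqa1 : q ^ a ≤ 1 := pow_le_one₀ hq0.le hq1.le
  calc (binomialRandom (Fin n) p).real {G | (1 + ε) * x < (G.domHad : ℝ)}
      ≤ (binomialRandom (Fin n) p).real {G | G.HasDominatingModel t} := by
        refine measureReal_mono (fun G hG => ?_) (measure_ne_top _ _)
        have h1 : t ≤ G.domHad := (Nat.floor_lt (by positivity)).2 hG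
        exact (isGreatest_domHad G).1.mono h1
    _ ≤ ((t : ℝ) + 1) ^ n * (1 - q ^ a) ^ k.choose 2 := by
        simpa using binomialRandom_real_hasDominatingModel_le (V := Fin n) p hcount
    _ ≤ Real.exp (n * Real.log n) * Real.exp (-((n : ℝ) ^ (-β) * (ε ^ 2 * x ^ 2 / 32))) := by
        refine mul_le_mul ?_ ?_ (pow_nonneg (by linarith) _) (Real.exp_nonneg _)
        · rw [Real.exp_nat_mul, Real.exp_log hn0]
          gcongr
        · calc (1 - q ^ a) ^ k.choose 2 ≤ Real.exp (-q ^ a) ^ k.choose 2 := by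
                exact pow_le_pow_left₀ (by linarith) (Real.one_sub_le_exp_neg _) _
            _ = Real.exp (-(q ^ a * k.choose 2)) := by
                rw [← Real.exp_nat_mul]; ring_nf
            _ ≤ _ := by gcongr
    _ ≤ Real.exp (-(n : ℝ)) := by
        rw [← Real.exp_add]
        gcongr
        linarith

/-! ### The lower bound on the dominating Hadwiger number -/

/-- The vertices `j * s, …, j * s + s - 1`, the `j`-th of the consecutive disjoint blocks of length
`s`; the last `n % s` vertices lie in no block. -/
def blockFinset {n s : ℕ} (j : Fin (n / s)) : Finset (Fin n) :=
  Finset.univ.filter fun v => (v : ℕ) / s = j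

theorem card_blockFinset {n s : ℕ} (hs : 0 < s) (j : Fin (n / s)) :
    (blockFinset j).card = s := by
  have h1 : (j + 1) * s ≤ n := (Nat.le_div_iff_mul_le hs).1 j.2
  have h2 : (blockFinset j).map Fin.valEmbedding = Finset.Ico (j * s) ((j + 1) * s) := by
    ext v
    simp only [blockFinset, Finset.mem_map, Finset.mem_filter, Finset.mem_univ, true_and,
      Fin.valEmbedding_apply, Finset.mem_Ico]
    constructor
    · rintro ⟨w, hw, rfl⟩
      rw [← hw]
      have := Nat.lt_div_mul_add (a := (w : ℕ)) hs
      exact ⟨Nat.div_mul_le_self _ _, by linarith⟩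
    · rintro ⟨h3, h4⟩
      exact ⟨⟨v, h4.trans_le h1⟩, Nat.div_eq_of_lt_le h3 h4, rfl⟩
  rw [← Finset.card_map Fin.valEmbedding, h2, Nat.card_Ico, add_mul]
  omega

theorem disjoint_blockFinset {n s : ℕ} (i j : Fin (n / s)) (hij : i ≠ j) :
    Disjoint (blockFinset i) (blockFinset j) := by
  rw [Finset.disjoint_left]
  intro v hi hj
  simp only [blockFinset, Finset.mem_filter, Finset.mem_univ, true_and] at hi hj
  exact hij (Fin.ext (hi.symm.trans hj))

/-- Blocks of length about `(1 + δ) * L`: a vertex is not dominated by a given block with probability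
at most `n ^ (-(1 + δ))`, so a block is bad with probability tending to `0`. By Markov's
inequality, at most a `δ`-fraction of the blocks is bad with probability tending to `1`. -/
theorem tendsto_binomialRandom_real_domHad_lt {p : unitInterval} (hp0 : 0 < p) (hp1 : p < 1)
    {ε : ℝ} (hε : 0 < ε) :
    Tendsto (fun n : ℕ => (binomialRandom (Fin n) p).real
      {G | (G.domHad : ℝ) < (1 - ε) * (n / Real.logb (1 / (1 - (p : ℝ))) n)}) atTop (𝓝 0) := by
  have hp0' : (0 : ℝ) < p := hp0
  have hp1' : (p : ℝ) < 1 := hp1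
  set q : ℝ := 1 - p with hq
  have hq0 : 0 < q := by linarith
  have hq1 : q < 1 := by linarith
  set r : ℝ := 1 - (p : ℝ) ^ 2 with hr
  have hr0 : 0 < r := by nlinarith
  have hr1 : r < 1 := by nlinarith
  have hL := tendsto_logb_natCast_atTop hq0 hq1
  obtain ⟨δ, hδ0, hδ1, hδε⟩ : ∃ δ : ℝ, 0 < δ ∧ δ < 1 ∧ 1 - ε < (1 - δ) * (1 + δ)⁻¹ := by
    refine ⟨min ε 1 / 3, by positivity, by linarith [min_le_right ε 1], ?_⟩
    have h0 : 0 < min ε 1 := by positivity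
    rw [← div_eq_mul_inv, lt_div_iff₀ (by positivity)]
    nlinarith [min_le_left ε 1]
  let s : ℕ → ℕ := fun n => ⌈(1 + δ) * Real.logb (1 / q) n⌉₊
  have hs : Tendsto s atTop atTop :=
    tendsto_nat_ceil_atTop.comp (hL.const_mul_atTop (by positivity))
  have hη : Tendsto (fun n : ℕ => ((s n : ℝ) ^ 2 * r ^ (s n - 2) + (n : ℝ) ^ (-δ)) / δ)
      atTop (𝓝 0) := by
    have h1 : Tendsto (fun m : ℕ => (m : ℝ) ^ 2 * r ^ (m - 2)) atTop (𝓝 0) := by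
      have h := (tendsto_pow_const_mul_const_pow_of_abs_lt_one 2
        (abs_lt.2 ⟨by linarith, hr1⟩)).div_const (r ^ 2)
      rw [zero_div] at h
      refine h.congr' ?_
      filter_upwards [eventually_ge_atTop 2] with m hm
      rw [pow_sub₀ _ hr0.ne' hm]
      ring
    have h2 : Tendsto (fun n : ℕ => (n : ℝ) ^ (-δ)) atTop (𝓝 0) :=
      (tendsto_rpow_neg_atTop hδ0).comp tendsto_natCast_atTop_atTop
    simpa using ((h1.comp hs).add h2).div_const δ
  -- the number of blocks is `(1 + δ)⁻¹ * n / L` up to lower order terms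
  have hcount : ∀ᶠ n : ℕ in atTop,
      1 - ε < (1 - δ) * (Real.logb (1 / q) n / s n - Real.logb (1 / q) n / n) := by
    have h1 : Tendsto (fun n : ℕ => Real.logb (1 / q) n / s n) atTop (𝓝 (1 + δ)⁻¹) := by
      have h := ((tendsto_nat_ceil_mul_div_atTop (R := ℝ) (a := 1 + δ) (by positivity)).comp
        hL).inv₀ (by positivity)
      simpa [Function.comp_def, s] using h
    have h2 : Tendsto (fun n : ℕ => Real.logb (1 / q) n / n) atTop (𝓝 0) :=
      tendsto_logb_natCast_div_nhds_zero q
    have h3 := (h1.sub h2).const_mul (1 - δ)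
    rw [sub_zero] at h3
    exact h3.eventually_const_lt hδε
  refine squeeze_zero' (.of_forall fun n => measureReal_nonneg) ?_ hη
  filter_upwards [hcount, hs.eventually_ge_atTop 1, hL.eventually_gt_atTop 0,
    eventually_ge_atTop 1] with n hn hs1 hL0 hn1
  set L := Real.logb (1 / q) n with hLdef
  have hn0 : (0 : ℝ) < n := by exact_mod_cast hn1
  have hs0 : (0 : ℝ) < s n := by exact_mod_cast hs1
  set t := n / s n with ht
  have ht1 : (n : ℝ) / s n - 1 ≤ t := by
    have := Nat.lt_div_mul_add (a := n) hs1
    have h : (n : ℝ) < t * s n + s n := by exact_mod_cast this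
    rw [sub_le_iff_le_add, div_le_iff₀ hs0]
    linarith
  have ht2 : (s n : ℝ) * t ≤ n := by exact_mod_cast Nat.mul_div_le n (s n)
  have hgoal : (1 - ε) * (n / L) ≤ t - δ * t := by
    calc (1 - ε) * (n / L) ≤ (1 - δ) * (L / s n - L / n) * (n / L) := by gcongr
      _ = (1 - δ) * (n / s n - 1) := by field_simp
      _ ≤ (1 - δ) * t := by gcongr
      _ = _ := by ring
  have hqs : q ^ s n ≤ (n : ℝ) ^ (-(1 + δ)) := by
    rw [← rpow_mul_logb_one_div hq0 hq1 (1 + δ) hn0, ← Real.rpow_natCast]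
    exact Real.rpow_le_rpow_of_exponent_ge hq0 hq1.le (Nat.le_ceil _)
  rcases Nat.eq_zero_or_pos t with ht0 | ht0
  · -- with no blocks at all, the lower bound to be violated is at most `0`
    have : {G : SimpleGraph (Fin n) | (G.domHad : ℝ) < (1 - ε) * (n / L)} = ∅ := by
      refine Set.eq_empty_of_forall_notMem fun G (hG : (G.domHad : ℝ) < _) => ?_
      rw [ht0] at hgoal
      have : (0 : ℝ) ≤ G.domHad := by positivity
      simp at hgoal
      linarith
    rw [this, measureReal_empty]
    positivity
  have ht0' : (0 : ℝ) < t := by exact_mod_cast ht0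
  calc (binomialRandom (Fin n) p).real {G | (G.domHad : ℝ) < (1 - ε) * (n / L)}
      ≤ (binomialRandom (Fin n) p).real {G | (G.domHad : ℝ) < Fintype.card (Fin t) - δ * t} := by
        refine measureReal_mono (fun G (hG : (G.domHad : ℝ) < _) => ?_) (measure_ne_top _ _)
        rw [Set.mem_ofPred_eq, Fintype.card_fin]
        exact hG.trans_le hgoal
    _ ≤ Fintype.card (Fin t) * ((s n : ℝ) ^ 2 * r ^ (s n - 2) +
          s n * Fintype.card (Fin t) * q ^ s n) / (δ * t) :=
        binomialRandom_real_domHad_lt_le p (P := blockFinset) disjoint_blockFinset hs1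
          (card_blockFinset hs1) (by positivity)
    _ = ((s n : ℝ) ^ 2 * r ^ (s n - 2) + s n * t * q ^ s n) / δ := by
        rw [Fintype.card_fin]; field_simp
    _ ≤ ((s n : ℝ) ^ 2 * r ^ (s n - 2) + n * (n : ℝ) ^ (-(1 + δ))) / δ := by gcongr
    _ = _ := by
        rw [show -δ = -(1 + δ) + 1 by ring, Real.rpow_add_one hn0.ne']
        ring

end SimpleGraph

/-! ### Concentration of the dominating Hadwiger number -/

theorem mainTheorem5 (p : unitInterval) (hp0 : 0 < p) (hp1 : p < 1) (ε : ℝ) (hε : 0 < ε) :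
    Tendsto (fun n : ℕ => SimpleGraph.binomialRandom (Fin n) p
      {G : SimpleGraph (Fin n) |
        (1 - ε) * (n / Real.logb (1 / (1 - (p : ℝ))) n) ≤ (G.domHad : ℝ) ∧
        (G.domHad : ℝ) ≤ (1 + ε) * (n / Real.logb (1 / (1 - (p : ℝ))) n)})
      atTop (𝓝 1) := by
  rw [← ENNReal.tendsto_toReal_iff (fun _ => measure_ne_top _ _) ENNReal.one_ne_top,
    ENNReal.toReal_one]
  have h := (SimpleGraph.tendsto_binomialRandom_real_domHad_lt hp0 hp1 hε).add
    (SimpleGraph.tendsto_binomialRandom_real_lt_domHad hp0 hp1 hε)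
  have h' := h.const_sub 1
  rw [add_zero, sub_zero] at h'
  refine tendsto_of_tendsto_of_tendsto_of_le_of_le h' tendsto_const_nhds (fun n => ?_)
    fun n => measureReal_le_one
  change _ ≤ (SimpleGraph.binomialRandom (Fin n) p).real _
  rw [sub_le_comm, ← probReal_compl_eq_one_sub .of_discrete]
  refine (measureReal_mono (fun G hG => ?_) (measure_ne_top _ _)).trans
    (measureReal_union_le _ _)
  rw [Set.mem_compl_iff, Set.mem_ofPred_eq, not_and_or, not_le, not_le] at hG
  exact hG
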